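/- Let $a_1,\delta,\varepsilon,c_1>0$ and let $a_2,B,\beta_0,m$ be real numbers. Then there is an $N_0$, depending only on these numbers, such that the following holds for every integer $N\ge N_0$. Let levels $i=1,\dots,s$ be given with values $\lambda_i\in[0,B]$ and multiplicities $q_i\in\{0,1,2,\dots\}$, and let $Q=\sum_{i=1}^s q_i$ satisfy $a_1N\le Q\le a_2N$. A variant assigns a nonnegative integer to each of the $q_i$ states of each level $i$; let $N_i$ be the sum of these integers over the states of level $i$ (if all $q_i=1$, then $Q=s$ and a variant is just a sequence $N_1,\dots,N_s$ of nonnegative integers). For a real number $E$ let $\mathcal M$ be the set of all variants with $$\sum_{i=1}^s N_i=N,\qquad \sum_{i=1}^s\lambda_iN_i\le E ,$$ all of them taken as equiprobable, and let $\mathcal N\{\mathcal M\}$ be their number. Let $\beta'\in[0,\beta_0]$ and $\nu'$ be real numbers with $\beta'\lambda_i-\nu'>0$ for all $i$ and $$\sum_{i=1}^s\frac{q_i}{e^{\beta'\lambda_i-\nu'}-1}=N,\qquad \sum_{i=1}^s\frac{\lambda_iq_i}{e^{\beta'\lambda_i-\nu'}-1}=E,$$ where for $\beta'=0$ the last equality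 may be replaced by $\le E$. Assume that $e^{\beta_0B}<1+a_1$ or that $\beta'\lambda_i-\nu'\ge\delta$ for all $i$. Then for every $l$ with $\sum_{i=1}^l q_i\ge\varepsilon Q$ the number of variants in $\mathcal M$ with $$\Bigl|\sum_{i=1}^lN_i-\sum_{i=1}^l\frac{q_i}{e^{\beta'\lambda_i-\nu'}-1}\Bigr|\ge N^{3/4+\varepsilon}$$ is less than $c_1\,\mathcal N\{\mathcal M\}/N^m$. -/

import Mathlib

namespace OperationalRisk

/-- A variant: level `i` (for `i = 1, …, s`) has multiplicity `q i`, i.e. it consists of `q i`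
states, and a variant assigns a nonnegative integer to every state of every level. If all
multiplicities are `1`, a variant is just a sequence `N_1, …, N_s` of nonnegative integers. -/
abbrev Variant {s : ℕ} (q : Fin s → ℕ) : Type := (Σ i : Fin s, Fin (q i)) → ℕ

/-- The number `N_i` of a variant: the total over the `q i` states of level `i`. -/
def levelNumber {s : ℕ} {q : Fin s → ℕ} (n : Variant q) (i : Fin s) : ℕ :=
  ∑ k : Fin (q i), n ⟨i, k⟩

/-- The set `𝓜` of the variants with `∑ N_i = N` and `∑ λ_i N_i ≤ E`. -/
def admissible {s : ℕ} (q : Fin s → ℕ) (lam : Fin s → ℝ) (N : ℕ) (E : ℝ) : Set (Variant q) :=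
  {n | ∑ i, levelNumber n i = N ∧ ∑ i, lam i * (levelNumber n i : ℝ) ≤ E}

/-- The Bose–Einstein value `q_i / (exp (β λ_i - ν) - 1)`. -/
noncomputable def boseEinstein {s : ℕ} (q : Fin s → ℕ) (lam : Fin s → ℝ) (β ν : ℝ)
    (i : Fin s) : ℝ :=
  (q i : ℝ) / (Real.exp (β * lam i - ν) - 1)

/-- The indices of the first `l` levels. -/
def firstLevels (s l : ℕ) : Finset (Fin s) := Finset.univ.filter fun i => (i : ℕ) < l

/-- The admissible variants whose partial sum `∑_{i ≤ l} N_i` deviates from the Bose–Einstein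
partial sum by at least `Δ`. -/
def deviating {s : ℕ} (q : Fin s → ℕ) (lam : Fin s → ℝ) (N : ℕ) (E β ν : ℝ) (l : ℕ) (Δ : ℝ) :
    Set (Variant q) :=
  {n ∈ admissible q lam N E |
    Δ ≤ |∑ i ∈ firstLevels s l, (levelNumber n i : ℝ) -
      ∑ i ∈ firstLevels s l, boseEinstein q lam β ν i|}

/-- There are finitely many admissible variants, so that `Set.ncard` counts them. -/
theorem admissible_finite {s : ℕ} (q : Fin s → ℕ) (lam : Fin s → ℝ) (N : ℕ) (E : ℝ) :
    (admissible q lam N E).Finite := by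
  refine (Set.finite_Iic (fun _ => N : Variant q)).subset ?_
  rintro n ⟨h, -⟩ ⟨i, k⟩
  calc n ⟨i, k⟩ ≤ levelNumber n i :=
        Finset.single_le_sum (f := fun k => n ⟨i, k⟩) (fun _ _ => Nat.zero_le _)
          (Finset.mem_univ k)
    _ ≤ ∑ i, levelNumber n i :=
        Finset.single_le_sum (f := fun i => levelNumber n i) (fun _ _ => Nat.zero_le _)
          (Finset.mem_univ i)
    _ = N := h

end OperationalRisk

/-! Give the states independent geometric occupation numbers with reduced energies `h j = β' * lam j
- ν'`, so that the means are the Bose–Einstein values. The probability of a pattern `n` is a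
constant times `exp (-∑ h j * n j)`. On `𝓜` this exponent is affine in the energy, so every
admissible pattern has at least the weight `W` of the mean exponent. Chernoff's bound with tilt `N ^
(-1/4)` makes a deviation `N ^ (3/4 + ε)` as rare as `exp (O(√N) - N ^ (1/2 + ε))`, and dividing by
`W` bounds the number of deviating variants (`ncard_deviatingPatterns_mul_le`).

It remains to show that `𝓜` has at least `exp (-O(√N)) / W` elements. Emptying the order `√N` states
of highest energy, and one state of lowest energy, releases more particles and energy than typical
fluctuations of the other states consume. With probability at least `1/4` those states can therefore
be completed to an admissible pattern by putting all missing particles into the lowest state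
(`quarter_le_ncard_patterns_mul`). The emptied states change the weight only by `exp (O(√N))`
(`weight_compl_le`). No local limit theorem is needed, since `N ^ (1/2 + ε)` beats every `O(√N)`.

All constants are uniform because the reduced energies stay in a fixed interval `[g, G]` with `g >
0` (`reducedEnergy_bounds` or the assumed gap). -/

namespace OperationalRisk

open MeasureTheory ProbabilityTheory

/-! ### Exponential moments of one geometric variable -/

/-- The mean occupation number of a state with reduced energy `h`. -/
noncomputable def occupation (h : ℝ) : ℝ := 1 / (Real.exp h - 1)

/-- The probability that a state with reduced energy `h` is empty. -/
noncomputable def vacancy (h : ℝ) : unitInterval :=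
  Set.projIcc 0 1 zero_le_one (1 - Real.exp (-h))

theorem occupation_pos {h : ℝ} (hh : 0 < h) : 0 < occupation h :=
  one_div_pos.2 (sub_pos.2 (Real.one_lt_exp_iff.2 hh))

theorem occupation_anti {g h : ℝ} (hg : 0 < g) (hgh : g ≤ h) : occupation h ≤ occupation g :=
  one_div_le_one_div_of_le (sub_pos.2 (Real.one_lt_exp_iff.2 hg))
    (sub_le_sub_right (Real.exp_le_exp.2 hgh) 1)

theorem coe_vacancy {h : ℝ} (hh : 0 < h) : (vacancy h : ℝ) = 1 - Real.exp (-h) := by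
  have h1 : Real.exp (-h) < 1 := Real.exp_lt_one_iff.2 (by linarith)
  have h2 := Real.exp_pos (-h)
  rw [vacancy, Set.projIcc_of_mem zero_le_one (x := 1 - Real.exp (-h)) ⟨by linarith, by linarith⟩]

theorem vacancy_pos {h : ℝ} (hh : 0 < h) : 0 < (vacancy h : ℝ) := by
  rw [coe_vacancy hh]
  linarith [Real.exp_lt_one_iff.2 (neg_lt_zero.2 hh)]

theorem vacancy_ne_zero {h : ℝ} (hh : 0 < h) : vacancy h ≠ 0 := fun h0 => by
  have := vacancy_pos hh
  rw [h0] at this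
  simp at this

theorem vacancy_mono {g h : ℝ} (hg : 0 < g) (hgh : g ≤ h) :
    (vacancy g : ℝ) ≤ (vacancy h : ℝ) := by
  rw [coe_vacancy hg, coe_vacancy (hg.trans_le hgh)]
  linarith [Real.exp_le_exp.2 (neg_le_neg hgh)]

theorem exp_neg_le_one_sub {y : ℝ} (hy : y ≤ 1 / 2) : Real.exp (-(y + 2 * y ^ 2)) ≤ 1 - y := by
  rw [Real.exp_neg]
  refine inv_le_of_inv_le₀ (by linarith) ?_
  rw [inv_le_iff_one_le_mul₀ (by linarith)]
  -- `(1 + y + 2y²)(1 - y) = 1 + y²(1 - 2y) ≥ 1`.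
  have h1 := Real.add_one_le_exp (y + 2 * y ^ 2)
  nlinarith [mul_le_mul_of_nonneg_right h1 (by linarith : 0 ≤ 1 - y),
    mul_nonneg (sq_nonneg y) (by linarith : 0 ≤ 1 - 2 * y)]

/-- A geometric series of ratio `exp (θ - h)`. Written through the mean, the moment generating
function depends on `h` only via `occupation h`, which makes bounds uniform in `h`. -/
theorem hasSum_exp_geometric {h θ : ℝ} (hh : 0 < h)
    (hy : occupation h * (Real.exp θ - 1) < 1) :
    HasSum (fun n : ℕ => (1 - (vacancy h : ℝ)) ^ n * (vacancy h : ℝ) * Real.exp (θ * n))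
      (1 - occupation h * (Real.exp θ - 1))⁻¹ := by
  have he : 1 < Real.exp h := Real.one_lt_exp_iff.2 hh
  have hlt : Real.exp (θ - h) < 1 := by
    rw [Real.exp_sub, div_lt_one (by positivity)]
    rw [occupation, div_mul_eq_mul_div, one_mul, div_lt_one (by linarith)] at hy
    linarith
  have key := (hasSum_geometric_of_lt_one (Real.exp_pos _).le hlt).mul_left (vacancy h : ℝ)
  convert! key using 1
  · funext n
    rw [coe_vacancy hh, sub_sub_cancel, ← Real.exp_nat_mul, ← Real.exp_nat_mul, mul_right_comm,
      ← Real.exp_add, mul_comm]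
    congr 2
    ring
  · have h1 : 1 - Real.exp (θ - h) ≠ 0 := by linarith
    have h2 : Real.exp h - 1 ≠ 0 := by linarith
    rw [coe_vacancy hh, occupation, ← div_eq_mul_inv, inv_eq_one_div, div_eq_div_iff]
    · rw [Real.exp_sub, Real.exp_neg]
      field_simp
      ring
    · linarith [show occupation h * (Real.exp θ - 1) =
        1 / (Real.exp h - 1) * (Real.exp θ - 1) from rfl]
    · exact h1

/-- Second-order expansion in `θ`: with `y = n * (exp θ - 1)` one has `|y| ≤ 2b|θ|`, so `2y²`
contributes `8b²θ²` and the Taylor remainder of `exp` contributes `bθ²`. The linear term is the one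
removed by centring. -/
theorem occupation_mul_exp_sub_one_le {n b θ : ℝ} (hn : 0 ≤ n) (hb : n ≤ b) (h1 : |θ| ≤ 1)
    (h2 : 4 * b * |θ| ≤ 1) :
    n * (Real.exp θ - 1) ≤ 1 / 2 ∧
      n * (Real.exp θ - 1) + 2 * (n * (Real.exp θ - 1)) ^ 2 ≤ θ * n + (b + 8 * b ^ 2) * θ ^ 2 := by
  have h3 := abs_le.1 (Real.abs_exp_sub_one_sub_id_le h1)
  have h4 : |Real.exp θ - 1| ≤ 2 * |θ| := Real.abs_exp_sub_one_le h1
  have h5 : |n * (Real.exp θ - 1)| ≤ 2 * b * |θ| := by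
    rw [abs_mul, abs_of_nonneg hn]
    calc n * |Real.exp θ - 1| ≤ b * (2 * |θ|) := by gcongr; exact hn.trans hb
      _ = _ := by ring
  refine ⟨(le_abs_self _).trans (by linarith), ?_⟩
  have h6 : (n * (Real.exp θ - 1)) ^ 2 ≤ 4 * b ^ 2 * θ ^ 2 := by
    rw [← sq_abs (n * _), ← sq_abs θ]
    calc |n * (Real.exp θ - 1)| ^ 2 ≤ (2 * b * |θ|) ^ 2 := by gcongr
      _ = _ := by ring
  have h7 : n * (Real.exp θ - 1 - θ) ≤ b * θ ^ 2 := by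
    calc n * (Real.exp θ - 1 - θ) ≤ n * θ ^ 2 := by gcongr; exact h3.2
      _ ≤ _ := by gcongr
  nlinarith

theorem integrable_exp_geometricMeasure {h θ : ℝ} (hh : 0 < h)
    (hy : occupation h * (Real.exp θ - 1) < 1) (c : ℝ) :
    Integrable (fun n : ℕ => Real.exp (θ * (n - c))) (geometricMeasure (vacancy h)) := by
  rw [integrable_geometricMeasure_iff (vacancy_ne_zero hh)]
  convert! (hasSum_exp_geometric hh hy).summable.mul_right (Real.exp (-(θ * c))) using 2 with n
  rw [Real.norm_eq_abs, Real.abs_exp, mul_assoc _ (Real.exp _), ← Real.exp_add]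
  congr 2
  ring

theorem integral_exp_geometricMeasure_le {h θ b : ℝ} (hh : 0 < h) (hb : occupation h ≤ b)
    (h1 : |θ| ≤ 1) (h2 : 4 * b * |θ| ≤ 1) :
    ∫ n : ℕ, Real.exp (θ * (n - occupation h)) ∂geometricMeasure (vacancy h) ≤
      Real.exp ((b + 8 * b ^ 2) * θ ^ 2) := by
  obtain ⟨hy, hy'⟩ := occupation_mul_exp_sub_one_le (occupation_pos hh).le hb h1 h2
  have hs := (hasSum_exp_geometric hh (hy.trans_lt (by norm_num))).mul_right
    (Real.exp (-(θ * occupation h)))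
  rw [integral_geometricMeasure (vacancy_ne_zero hh)]
  have : ∀ n : ℕ, ((1 - (vacancy h : ℝ)) ^ n * (vacancy h : ℝ)) •
      Real.exp (θ * (n - occupation h)) = (1 - (vacancy h : ℝ)) ^ n * (vacancy h : ℝ) *
        Real.exp (θ * n) * Real.exp (-(θ * occupation h)) := fun n => by
    rw [smul_eq_mul, mul_assoc _ (Real.exp _), ← Real.exp_add]
    congr 2
    ring
  rw [tsum_congr this, hs.tsum_eq]
  have h3 := exp_neg_le_one_sub hy
  calc _ ≤ (Real.exp (-(occupation h * (Real.exp θ - 1) +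
        2 * (occupation h * (Real.exp θ - 1)) ^ 2)))⁻¹ * Real.exp (-(θ * occupation h)) := by
        gcongr
    _ ≤ _ := by
        rw [← Real.exp_neg, neg_neg, ← Real.exp_add]
        gcongr
        linarith

/-! ### Independent geometric variables and Chernoff's bound -/

section Product

variable {J : Type*} [Fintype J]

/-- The law of independent geometric occupation numbers with reduced energies `h`. -/
noncomputable def boseMeasure (h : J → ℝ) : Measure (J → ℕ) :=
  Measure.pi fun j => geometricMeasure (vacancy (h j))

instance (h : J → ℝ) : IsProbabilityMeasure (boseMeasure h) := by
  unfold boseMeasure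
  infer_instance

theorem boseMeasure_real_singleton {h : J → ℝ} (hh : ∀ j, 0 < h j) (n : J → ℕ) :
    (boseMeasure h).real {n} =
      (∏ j, (vacancy (h j) : ℝ)) * Real.exp (-∑ j, h j * n j) := by
  rw [boseMeasure, measureReal_def, Measure.pi_singleton, ENNReal.toReal_prod,
    ← Finset.sum_neg_distrib, Real.exp_sum, ← Finset.prod_mul_distrib]
  refine Finset.prod_congr rfl fun j _ => ?_
  rw [← measureReal_def, geometricMeasure_real_singleton (vacancy_ne_zero (hh j)),
    coe_vacancy (hh j), sub_sub_cancel, ← Real.exp_nat_mul, mul_comm]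
  congr 2
  ring

/-- Chernoff's bound for linear statistics of independent geometric variables. -/
theorem boseMeasure_real_deviation_le {h : J → ℝ} {b : ℝ} (hh : ∀ j, 0 < h j)
    (hb : ∀ j, occupation (h j) ≤ b) (θ : J → ℝ) {η : ℝ} (hθ : ∀ j, |θ j| ≤ η) (h1 : η ≤ 1)
    (h2 : 4 * b * η ≤ 1) (hb0 : 0 ≤ b) (r : ℝ) :
    (boseMeasure h).real {n | r ≤ ∑ j, θ j * (n j - occupation (h j))} ≤
      Real.exp ((b + 8 * b ^ 2) * η ^ 2 * Fintype.card J - r) := by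
  have hθ1 : ∀ j, |θ j| ≤ 1 := fun j => (hθ j).trans h1
  have hθ2 : ∀ j, 4 * b * |θ j| ≤ 1 := fun j =>
    (mul_le_mul_of_nonneg_left (hθ j) (by positivity)).trans h2
  have hexp : ∀ n : J → ℕ, Real.exp (1 * ∑ j, θ j * ((n j : ℝ) - occupation (h j))) =
      ∏ j, Real.exp (θ j * ((n j : ℝ) - occupation (h j))) := fun n => by
    rw [one_mul, Real.exp_sum]
  have hint : Integrable (fun n : J → ℕ => Real.exp (1 * ∑ j, θ j * ((n j : ℝ) -
      occupation (h j)))) (boseMeasure h) := by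
    simp only [hexp]
    exact Integrable.fintype_prod_dep
      (f := fun j (k : ℕ) => Real.exp (θ j * ((k : ℝ) - occupation (h j)))) fun j =>
        integrable_exp_geometricMeasure (hh j)
          ((occupation_mul_exp_sub_one_le (occupation_pos (hh j)).le (hb j) (hθ1 j)
            (hθ2 j)).1.trans_lt (by norm_num)) _
  -- The tilt is already contained in the coefficients `θ j`, so the moment generating function is
  -- taken at `1`.
  refine (measure_ge_le_exp_mul_mgf r zero_le_one hint).trans ?_
  have hmgf : mgf (fun n : J → ℕ => ∑ j, θ j * ((n j : ℝ) - occupation (h j)))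
      (boseMeasure h) 1 ≤ Real.exp ((b + 8 * b ^ 2) * η ^ 2 * Fintype.card J) := by
    unfold mgf
    simp only [hexp]
    rw [boseMeasure, integral_fintype_prod_eq_prod
      (fun j (k : ℕ) => Real.exp (θ j * ((k : ℝ) - occupation (h j))))]
    calc _ ≤ ∏ _j : J, Real.exp ((b + 8 * b ^ 2) * η ^ 2) := by
          refine Finset.prod_le_prod (fun j _ => integral_nonneg fun _ => (Real.exp_pos _).le)
            fun j _ => (integral_exp_geometricMeasure_le (hh j) (hb j) (hθ1 j) (hθ2 j)).trans ?_
          refine Real.exp_le_exp.2 (mul_le_mul_of_nonneg_left ?_ (by positivity))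
          exact sq_le_sq' (by linarith [neg_abs_le (θ j), hθ j]) ((le_abs_self _).trans (hθ j))
      _ = _ := by
          rw [Finset.prod_const, ← Real.exp_nat_mul, Finset.card_univ, mul_comm]
  calc _ ≤ Real.exp (-1 * r) * Real.exp ((b + 8 * b ^ 2) * η ^ 2 * Fintype.card J) := by gcongr
    _ = _ := by
      rw [← Real.exp_add]
      congr 1
      ring

end Product

/-! ### Counting patterns: upper bound for the deviating ones -/

section Counting

variable {J : Type*} [Fintype J]

/-- The occupation patterns of the states `J` with `N` particles and energy at most `E`. -/
def patterns (lam : J → ℝ) (N : ℕ) (E : ℝ) : Set (J → ℕ) :=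
  {n | ∑ j, n j = N ∧ ∑ j, lam j * (n j : ℝ) ≤ E}

theorem patterns_finite (lam : J → ℝ) (N : ℕ) (E : ℝ) : (patterns lam N E).Finite := by
  classical
  refine (Set.finite_Iic (fun _ => N : J → ℕ)).subset ?_
  rintro n ⟨h, -⟩ j
  exact h ▸ Finset.single_le_sum (f := n) (fun _ _ => Nat.zero_le _) (Finset.mem_univ j)

/-- The patterns whose number of particles in `F` deviates from its mean by at least `Δ`. -/
def deviatingPatterns (lam : J → ℝ) (N : ℕ) (E : ℝ) (h : J → ℝ) (F : Finset J) (Δ : ℝ) :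
    Set (J → ℕ) :=
  {n ∈ patterns lam N E | Δ ≤ |∑ j ∈ F, (n j : ℝ) - ∑ j ∈ F, occupation (h j)|}

theorem measureReal_eq_sum_singleton {α : Type*} [MeasurableSpace α] [MeasurableSingletonClass α]
    (μ : Measure α) [IsFiniteMeasure μ] {T : Set α} (hT : T.Finite) :
    μ.real T = ∑ n ∈ hT.toFinset, μ.real {n} := by
  rw [sum_measureReal_singleton, hT.coe_toFinset]

theorem ncard_mul_le_measureReal {α : Type*} [MeasurableSpace α] [MeasurableSingletonClass α]
    (μ : Measure α) [IsFiniteMeasure μ] {T : Set α} (hT : T.Finite) {c : ℝ}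
    (hc : ∀ n ∈ T, c ≤ μ.real {n}) : T.ncard * c ≤ μ.real T := by
  rw [measureReal_eq_sum_singleton μ hT, Set.ncard_eq_toFinset_card T hT, ← nsmul_eq_mul]
  exact Finset.card_nsmul_le_sum _ _ _ fun n hn => hc n (hT.mem_toFinset.1 hn)

theorem measureReal_le_ncard_mul {α : Type*} [MeasurableSpace α] [MeasurableSingletonClass α]
    (μ : Measure α) [IsFiniteMeasure μ] {T : Set α} (hT : T.Finite) {c : ℝ}
    (hc : ∀ n ∈ T, μ.real {n} ≤ c) : μ.real T ≤ T.ncard * c := by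
  rw [measureReal_eq_sum_singleton μ hT, Set.ncard_eq_toFinset_card T hT, ← nsmul_eq_mul]
  exact Finset.sum_le_card_nsmul _ _ _ fun n hn => hc n (hT.mem_toFinset.1 hn)

/-- The chance of a deviation bounds the number of deviating patterns. -/
theorem ncard_deviatingPatterns_mul_le {lam h : J → ℝ} {N : ℕ} {E β ν b η : ℝ}
    (hh : ∀ j, 0 < h j) (hdef : ∀ j, h j = β * lam j - ν) (hβ : 0 ≤ β)
    (hN : ∑ j, occupation (h j) = N) (hE : β * ∑ j, lam j * occupation (h j) = β * E)
    (hb : ∀ j, occupation (h j) ≤ b) (hb0 : 0 ≤ b) (hη0 : 0 ≤ η) (hη1 : η ≤ 1)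
    (hη2 : 4 * b * η ≤ 1) (F : Finset J) (Δ : ℝ) :
    (deviatingPatterns lam N E h F Δ).ncard *
        ((∏ j, (vacancy (h j) : ℝ)) * Real.exp (-∑ j, h j * occupation (h j))) ≤
      2 * Real.exp ((b + 8 * b ^ 2) * η ^ 2 * Fintype.card J - η * Δ) := by
  classical
  -- The energy condition enters only multiplied by `β`; this covers both the active bound and `β =
  -- 0`.
  have hmean : ∑ j, h j * occupation (h j) = β * E - ν * N := by
    rw [← hE, ← hN, Finset.mul_sum, Finset.mul_sum, ← Finset.sum_sub_distrib]
    refine Finset.sum_congr rfl fun j _ => ?_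
    rw [hdef j]
    ring
  have hfin : (deviatingPatterns lam N E h F Δ).Finite :=
    (patterns_finite lam N E).subset fun n hn => hn.1
  refine (ncard_mul_le_measureReal (boseMeasure h) hfin ?_).trans ?_
  · rintro n ⟨⟨hn1, hn2⟩, -⟩
    rw [boseMeasure_real_singleton hh]
    refine mul_le_mul_of_nonneg_left (Real.exp_le_exp.2 (neg_le_neg ?_))
      (Finset.prod_nonneg fun j _ => (vacancy_pos (hh j)).le)
    have : ∑ j, h j * (n j : ℝ) = β * ∑ j, lam j * (n j : ℝ) - ν * N := by
      rw [← hn1, Nat.cast_sum, Finset.mul_sum, Finset.mul_sum, ← Finset.sum_sub_distrib]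
      refine Finset.sum_congr rfl fun j _ => ?_
      rw [hdef j]
      ring
    rw [this, hmean]
    linarith [mul_le_mul_of_nonneg_left hn2 hβ]
  -- The two signs `σ = ±1` treat deviations upwards and downwards.
  · have hdev := fun (σ : ℝ) (hσ : |σ| = 1) =>
      boseMeasure_real_deviation_le hh hb (fun j => if j ∈ F then σ * η else 0) (η := η)
        (fun j => by
          split_ifs
          · rw [abs_mul, hσ, one_mul, abs_of_nonneg hη0]
          · rwa [abs_zero]) hη1 hη2 hb0 (η * Δ)
    have hsub : deviatingPatterns lam N E h F Δ ⊆
        {n | η * Δ ≤ ∑ j, (if j ∈ F then 1 * η else 0) * ((n j : ℝ) - occupation (h j))} ∪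
        {n | η * Δ ≤ ∑ j, (if j ∈ F then -1 * η else 0) * ((n j : ℝ) - occupation (h j))} := by
      rintro n ⟨-, hn⟩
      have hsum : ∀ σ : ℝ, ∑ j, (if j ∈ F then σ * η else 0) * ((n j : ℝ) - occupation (h j)) =
          η * (σ * (∑ j ∈ F, (n j : ℝ) - ∑ j ∈ F, occupation (h j))) := fun σ => by
        simp only [ite_mul, zero_mul]
        rw [Finset.sum_ite_mem, Finset.univ_inter, ← Finset.mul_sum, Finset.sum_sub_distrib]
        ring
      simp only [Set.mem_union, Set.mem_ofPred_eq, hsum]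
      refine (le_abs.1 hn).imp (fun h1 => ?_) fun h1 => ?_
      · exact mul_le_mul_of_nonneg_left (by linarith) hη0
      · exact mul_le_mul_of_nonneg_left (by linarith) hη0
    refine (measureReal_mono hsub).trans ((measureReal_union_le _ _).trans ?_)
    linarith [hdev 1 (by simp), hdev (-1) (by simp)]

/-! ### Counting patterns: lower bound for the admissible ones -/

/-- Extension of a pattern off `S` by `k` particles in the state `j₀` of `S`. -/
noncomputable def fillUp (S : Set J) (j₀ : J) (k : ℕ) (n : {j // j ∉ S} → ℕ) (j : J) : ℕ :=
  open Classical in if hj : j ∉ S then n ⟨j, hj⟩ else if j = j₀ then k else 0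

theorem sum_mul_fillUp {S : Set J} [Fintype {j // j ∉ S}] {j₀ : J} (hj₀ : j₀ ∈ S) (k : ℕ)
    (n : {j // j ∉ S} → ℕ)
    (c : J → ℝ) : ∑ j, c j * (fillUp S j₀ k n j : ℝ) = c j₀ * k + ∑ j, c j.1 * (n j : ℝ) := by
  classical
  rw [← Fintype.sum_subtype_add_sum_subtype (fun j => j ∈ S)
    (fun j => c j * (fillUp S j₀ k n j : ℝ))]
  congr 1
  · rw [Fintype.sum_eq_single
      (f := fun j : {j // j ∈ S} => c j * (fillUp S j₀ k n j : ℝ)) ⟨j₀, hj₀⟩]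
    · simp [fillUp, hj₀]
    · rintro ⟨j, hj⟩ hne
      have : j ≠ j₀ := fun h => hne (Subtype.ext h)
      simp [fillUp, hj, this]
  · exact Finset.sum_congr (by ext; simp) fun j _ => by simp [fillUp, j.2]

theorem four_mul_exp_neg_two_le : 4 * Real.exp (-2) ≤ 1 := by
  have h1 := Real.add_one_le_exp (1 : ℝ)
  have h2 : Real.exp 2 = Real.exp 1 * Real.exp 1 := by
    rw [← Real.exp_add]
    norm_num
  rw [Real.exp_neg, ← div_eq_mul_inv, div_le_one (Real.exp_pos _), h2]
  nlinarith

/-- Lower bound for the number of patterns: keep only those for which a set `S` of states of high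
energy is empty, except for one state of minimal energy in `S` which takes up the rest. -/
theorem quarter_le_ncard_patterns_mul {lam h : J → ℝ} {N : ℕ} {E b G a x D : ℝ} {S : Set J}
    [Fintype {j // j ∉ S}] {j₀ : J} (hj₀ : j₀ ∈ S)
    (hh : ∀ j, 0 < h j) (hG : ∀ j, h j ≤ G) (hG0 : 0 < G)
    (hN : ∑ j, occupation (h j) = N) (hE : ∑ j, lam j * occupation (h j) ≤ E)
    (hb : ∀ j, occupation (h j) ≤ b) (hb0 : 0 ≤ b) (hx1 : 1 ≤ x) (hx2 : 4 * b ≤ x)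
    (hcard : (Fintype.card J : ℝ) ≤ a * x ^ 2) (hD : 0 ≤ D) (hmin : ∀ j, lam j₀ ≤ lam j)
    (hlam : ∀ j ∉ S, lam j - lam j₀ ≤ D)
    (hS1 : ∑ j : {j // j ∉ S}, occupation (h j) + ((b + 8 * b ^ 2) * a + 2) * x ≤
      ∑ j, occupation (h j))
    (hS2 : ∑ j : {j // j ∉ S}, (lam j - lam j₀) * occupation (h j) +
      D * (((b + 8 * b ^ 2) * a + 2) * x) ≤ ∑ j, (lam j - lam j₀) * occupation (h j)) :
    1 / 4 ≤ (patterns lam N E).ncard * ((∏ j : {j // j ∉ S}, (vacancy (h j) : ℝ)) *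
      Real.exp (-(∑ j : {j // j ∉ S}, h j * occupation (h j) -
        G * (((b + 8 * b ^ 2) * a + 2) * x)))) := by
  classical
  -- With tilts of size `1 / x`, the quadratic term of Chernoff's bound is at most `(b + 8b²)a`; the
  -- extra `2` leaves probability `exp (-2)` for each bad event.
  set C : ℝ := (b + 8 * b ^ 2) * a + 2 with hC
  have hx0 : 0 < x := by linarith
  let R := {j // j ∉ S}
  let μ : Measure (R → ℕ) := boseMeasure fun j => h j.1
  have hdev : ∀ u : R → ℝ, (∀ j, |u j| ≤ 1) →
      μ.real {n | C * x ≤ ∑ j, u j * ((n j : ℝ) - occupation (h j))} ≤ Real.exp (-2) := by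
    intro u hu
    have key := boseMeasure_real_deviation_le (h := fun j : R => h j.1) (fun j => hh j.1)
      (fun j => hb j.1) (fun j => u j / x) (η := 1 / x)
      (fun j => by
        rw [abs_div, abs_of_pos hx0]
        exact div_le_div_of_nonneg_right (hu j) hx0.le)
      (by rwa [div_le_one hx0]) (by rwa [mul_one_div, div_le_one hx0]) hb0 C
    refine (measureReal_mono fun n hn => ?_).trans (key.trans (Real.exp_le_exp.2 ?_))
    · simp only [Set.mem_ofPred_eq] at hn ⊢
      have h1 : ∑ j, u j / x * ((n j : ℝ) - occupation (h j.1)) =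
          (∑ j, u j * ((n j : ℝ) - occupation (h j.1))) / x := by
        rw [Finset.sum_div]
        exact Finset.sum_congr rfl fun j _ => by ring
      rw [h1, le_div_iff₀ hx0]
      exact hn
    · have h1 : (Fintype.card R : ℝ) ≤ a * x ^ 2 :=
        le_trans (by exact_mod_cast Fintype.card_subtype_le _) hcard
      have h2 : (1 / x) ^ 2 * (Fintype.card R : ℝ) ≤ a := by
        rw [one_div, inv_pow, inv_mul_le_iff₀ (by positivity), mul_comm]
        exact h1
      have h3 := mul_le_mul_of_nonneg_left h2 (by positivity : 0 ≤ b + 8 * b ^ 2)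
      rw [hC, mul_assoc]
      linarith
  -- The three conditions control the energy above `lam j₀`, the particle number, and the weight of
  -- the pattern from above. At most `3 * exp (-2) ≤ 3/4` of the probability is lost.
  let T : Set (R → ℕ) := {n |
    (∑ j, (lam j.1 - lam j₀) / D * ((n j : ℝ) - occupation (h j)) < C * x) ∧
    (∑ j, (1 : ℝ) * ((n j : ℝ) - occupation (h j.1)) < C * x) ∧
    (∑ j, (-(h j.1 / G)) * ((n j : ℝ) - occupation (h j)) < C * x)}
  have hu1 : ∀ j : R, |(lam j.1 - lam j₀) / D| ≤ 1 := fun j => by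
    rw [abs_div, abs_of_nonneg hD, abs_of_nonneg (sub_nonneg.2 (hmin j))]
    exact div_le_one_of_le₀ (hlam j.1 j.2) hD
  have hu3 : ∀ j : R, |-(h j.1 / G)| ≤ 1 := fun j => by
    rw [abs_neg, abs_of_pos (div_pos (hh j) hG0), div_le_one hG0]
    exact hG j
  have hTprob : 1 / 4 ≤ μ.real T := by
    have hcompl : Tᶜ ⊆ {n | C * x ≤ ∑ j, (lam j.1 - lam j₀) / D * ((n j : ℝ) - occupation (h j))} ∪
        ({n | C * x ≤ ∑ j, (1 : ℝ) * ((n j : ℝ) - occupation (h j.1))} ∪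
        {n | C * x ≤ ∑ j, (-(h j.1 / G)) * ((n j : ℝ) - occupation (h j))}) := by
      intro n hn
      simp only [T, Set.mem_compl_iff, Set.mem_ofPred_eq, not_and_or, not_lt] at hn
      exact hn
    have h1 := (measureReal_mono (μ := μ) hcompl).trans (measureReal_union_le _ _)
    have h2 := measureReal_union_le (μ := μ)
      {n : R → ℕ | C * x ≤ ∑ j, (1 : ℝ) * ((n j : ℝ) - occupation (h j.1))}
      {n | C * x ≤ ∑ j, (-(h j.1 / G)) * ((n j : ℝ) - occupation (h j))}
    have h3 : μ.real Tᶜ = 1 - μ.real T := probReal_compl_eq_one_sub (.of_discrete)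
    linarith [hdev _ hu1, hdev (fun _ => 1) (by simp), hdev _ hu3, four_mul_exp_neg_two_le]
  have hle : ∀ n ∈ T, ∑ j, n j ≤ N := fun n hn => by
    have h2 := hn.2.1
    simp only [one_mul, Finset.sum_sub_distrib] at h2
    have : (∑ j, (n j : ℝ)) ≤ N := by linarith
    exact_mod_cast this
  have hmaps : ∀ n ∈ T, fillUp S j₀ (N - ∑ j, n j) n ∈ patterns lam N E := by
    intro n hn
    have hcast : ((N - ∑ j, n j : ℕ) : ℝ) = N - ∑ j, (n j : ℝ) := by
      rw [Nat.cast_sub (hle n hn), Nat.cast_sum]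
    constructor
    · have := sum_mul_fillUp hj₀ (N - ∑ j, n j) n fun _ => 1
      simp only [one_mul, hcast] at this
      rw [sub_add_cancel] at this
      exact_mod_cast this
    -- Measured from the level `lam j₀`, the particles added in `j₀` cost no energy, so the first
    -- condition of `T` and the energy released by `S` suffice.
    · rw [sum_mul_fillUp hj₀, hcast]
      have h1 := mul_le_mul_of_nonneg_left hn.1.le hD
      have h2 : D * ∑ j : R, (lam j.1 - lam j₀) / D * ((n j : ℝ) - occupation (h j)) =
          ∑ j : R, (lam j.1 - lam j₀) * (n j : ℝ) -
            ∑ j : R, (lam j.1 - lam j₀) * occupation (h j) := by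
        rw [Finset.mul_sum, ← Finset.sum_sub_distrib]
        refine Finset.sum_congr rfl fun j _ => ?_
        rcases hD.eq_or_lt with h0 | h0
        -- If `D = 0`, the quotients by `D` are zero by convention and all energies off `S` equal
        -- `lam j₀`.
        · have : lam j.1 - lam j₀ = 0 :=
            le_antisymm (h0 ▸ hlam j.1 j.2) (sub_nonneg.2 (hmin j))
          rw [this]
          ring
        · field_simp
      have h3 : ∑ j : R, (lam j.1 - lam j₀) * (n j : ℝ) =
          ∑ j : R, lam j.1 * (n j : ℝ) - lam j₀ * ∑ j, (n j : ℝ) := by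
        rw [Finset.mul_sum, ← Finset.sum_sub_distrib]
        exact Finset.sum_congr rfl fun j _ => by ring
      have h4 : ∑ j, (lam j - lam j₀) * occupation (h j) =
          ∑ j, lam j * occupation (h j) - lam j₀ * N := by
        rw [← hN, Finset.mul_sum, ← Finset.sum_sub_distrib]
        exact Finset.sum_congr rfl fun j _ => by ring
      linarith
  have hinj : Set.InjOn (fun n : R → ℕ => fillUp S j₀ (N - ∑ j, n j) n) T := by
    intro n _ n' _ heq
    funext j
    simpa [fillUp, j.2] using congrFun heq j.1
  have hTfin : T.Finite :=
    Set.Finite.of_finite_image ((patterns_finite lam N E).subset (Set.image_subset_iff.2 hmaps)) hinj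
  have hTcard : (T.ncard : ℝ) ≤ (patterns lam N E).ncard := by
    exact_mod_cast Set.ncard_le_ncard_of_injOn _ hmaps hinj (patterns_finite lam N E)
  have hp : 0 ≤ ∏ j : R, (vacancy (h j) : ℝ) :=
    Finset.prod_nonneg fun j _ => (vacancy_pos (hh j)).le
  refine hTprob.trans ((measureReal_le_ncard_mul μ hTfin (c := (∏ j : R, (vacancy (h j) : ℝ)) *
      Real.exp (-(∑ j : R, h j * occupation (h j) - G * (C * x)))) ?_).trans ?_)
  · intro n hn
    rw [boseMeasure_real_singleton fun j : R => hh j.1]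
    refine mul_le_mul_of_nonneg_left (Real.exp_le_exp.2 (neg_le_neg ?_)) hp
    have h1 := mul_le_mul_of_nonneg_left hn.2.2.le hG0.le
    have h2 : G * ∑ j : R, (-(h j.1 / G)) * ((n j : ℝ) - occupation (h j)) =
        ∑ j : R, h j.1 * occupation (h j) - ∑ j : R, h j.1 * (n j : ℝ) := by
      rw [Finset.mul_sum, ← Finset.sum_sub_distrib]
      refine Finset.sum_congr rfl fun j _ => ?_
      field_simp
      ring
    linarith
  · exact mul_le_mul_of_nonneg_right hTcard (mul_nonneg hp (Real.exp_pos _).le)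

/-- The `k` largest values of a real function on a finite type. -/
theorem exists_top_finset (f : J → ℝ) {k : ℕ} (hk : k ≤ Fintype.card J) :
    ∃ S : Finset J, S.card = k ∧ ∀ i ∈ S, ∀ j ∉ S, f j ≤ f i := by
  classical
  induction k with
  | zero => exact ⟨∅, rfl, by simp⟩
  | succ k ih =>
    obtain ⟨S, hS, hf⟩ := ih (by omega)
    have hne : Sᶜ.Nonempty := by
      rw [← Finset.card_pos, Finset.card_compl]
      omega
    obtain ⟨i, hi, hmax⟩ := Sᶜ.exists_max_image f hne
    rw [Finset.mem_compl] at hi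
    refine ⟨insert i S, by rw [Finset.card_insert_of_notMem hi, hS], fun i' hi' j hj => ?_⟩
    rw [Finset.mem_insert, not_or] at hj
    rcases Finset.mem_insert.1 hi' with rfl | h'
    · exact hmax j (Finset.mem_compl.2 hj.2)
    · exact hf i' h' j hj.2

end Counting

/-! ### Choice of the emptied states and the cost of emptying them -/

theorem sum_add_sum_subtype_notMem {J : Type*} [Fintype J] (S : Finset J)
    [Fintype {j // j ∉ (S : Set J)}] (f : J → ℝ) :
    ∑ j ∈ S, f j + ∑ j : {j // j ∉ (S : Set J)}, f j = ∑ j, f j := by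
  classical
  rw [← Finset.sum_add_sum_compl S, ← Finset.sum_subtype Sᶜ (fun j => by simp) f]

theorem prod_mul_prod_subtype_notMem {J : Type*} [Fintype J] (S : Finset J)
    [Fintype {j // j ∉ (S : Set J)}] (f : J → ℝ) :
    (∏ j ∈ S, f j) * ∏ j : {j // j ∉ (S : Set J)}, f j = ∏ j, f j := by
  classical
  rw [← Finset.prod_mul_prod_compl S, ← Finset.prod_subtype Sᶜ (fun j => by simp) f]

/-- A set of at most `k + 1` states, consisting of the `k` states of highest energy and one state
of lowest energy. -/
theorem exists_extremal_states {J : Type*} [Fintype J] (lam occ : J → ℝ) {k : ℕ} {ρ y : ℝ}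
    (hk : k < Fintype.card J) (hρ : ∀ j, ρ ≤ occ j) (hρ0 : 0 ≤ ρ) (hy : y ≤ k * ρ) :
    ∃ (S : Finset J) (j₀ : J) (D : ℝ), S.card ≤ k + 1 ∧ j₀ ∈ S ∧ (∀ j, lam j₀ ≤ lam j) ∧ 0 ≤ D ∧
      (∀ j ∉ S, lam j - lam j₀ ≤ D) ∧ y ≤ ∑ j ∈ S, occ j ∧
      D * y ≤ ∑ j ∈ S, (lam j - lam j₀) * occ j := by
  classical
  obtain ⟨T, hT, hf⟩ := exists_top_finset lam hk.le
  have hne : Tᶜ.Nonempty := by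
    rw [← Finset.card_pos, Finset.card_compl]
    omega
  -- The highest energy outside `T` separates the two sets: `D = lam i - lam j₀` bounds the excess
  -- energy outside from above and that in `T` from below.
  obtain ⟨i, hi, hmax⟩ := Tᶜ.exists_max_image lam hne
  obtain ⟨j₀, -, hmin⟩ := Finset.univ.exists_min_image lam ⟨i, Finset.mem_univ i⟩
  have hmin' : ∀ j, lam j₀ ≤ lam j := fun j => hmin j (Finset.mem_univ j)
  have hD : 0 ≤ lam i - lam j₀ := sub_nonneg.2 (hmin' i)
  have hocc : ∀ j, 0 ≤ occ j := fun j => hρ0.trans (hρ j)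
  have hsum : y ≤ ∑ j ∈ T, occ j := by
    refine hy.trans ?_
    rw [← hT, ← nsmul_eq_mul]
    exact Finset.card_nsmul_le_sum _ _ _ fun j _ => hρ j
  refine ⟨insert j₀ T, j₀, lam i - lam j₀, hT ▸ Finset.card_insert_le _ _,
    Finset.mem_insert_self _ _, hmin', hD, fun j hj => ?_, ?_, ?_⟩
  · rw [Finset.mem_insert, not_or] at hj
    exact sub_le_sub_right (hmax j (Finset.mem_compl.2 hj.2)) _
  · exact hsum.trans (Finset.sum_le_sum_of_subset_of_nonneg (Finset.subset_insert _ _)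
      fun j _ _ => hocc j)
  · calc (lam i - lam j₀) * y ≤ (lam i - lam j₀) * ∑ j ∈ T, occ j :=
          mul_le_mul_of_nonneg_left hsum hD
      _ = ∑ j ∈ T, (lam i - lam j₀) * occ j := Finset.mul_sum _ _ _
      _ ≤ ∑ j ∈ T, (lam j - lam j₀) * occ j := Finset.sum_le_sum fun j hj =>
          mul_le_mul_of_nonneg_right
            (sub_le_sub_right (hf j hj i (Finset.mem_compl.1 hi)) _) (hocc j)
      _ ≤ _ := Finset.sum_le_sum_of_subset_of_nonneg (Finset.subset_insert _ _)
          fun j _ _ => mul_nonneg (sub_nonneg.2 (hmin' j)) (hocc j)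

/-- Emptying a set `S` of states costs a factor which is exponential in the size of `S`. -/
theorem weight_compl_le {J : Type*} [Fintype J] {S : Finset J}
    [Fintype {j // j ∉ (S : Set J)}] {h : J → ℝ} {g G t : ℝ} (hg : 0 < g) (hG : 0 ≤ G)
    (hgh : ∀ j, g ≤ h j) (hhG : ∀ j, h j ≤ G)
    (hS : (S.card : ℝ) ≤ t) (r : ℝ) :
    (∏ j : {j // j ∉ (S : Set J)}, (vacancy (h j) : ℝ)) *
        Real.exp (-(∑ j : {j // j ∉ (S : Set J)}, h j * occupation (h j) - r)) ≤
      (∏ j, (vacancy (h j) : ℝ)) * Real.exp (-∑ j, h j * occupation (h j)) *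
        Real.exp (t * -Real.log (vacancy g) + t * (G * occupation g) + r) := by
  have hh : ∀ j, 0 < h j := fun j => hg.trans_le (hgh j)
  have hpR : 0 ≤ ∏ j : {j // j ∉ (S : Set J)}, (vacancy (h j) : ℝ) :=
    Finset.prod_nonneg fun j _ => (vacancy_pos (hh j)).le
  have hlog : 0 ≤ -Real.log (vacancy g) :=
    neg_nonneg.2 (Real.log_nonpos (vacancy g).2.1 (vacancy g).2.2)
  have hpS : Real.exp (-(t * -Real.log (vacancy g))) ≤ ∏ j ∈ S, (vacancy (h j) : ℝ) := by
    calc Real.exp (-(t * -Real.log (vacancy g))) ≤ Real.exp (S.card * Real.log (vacancy g)) := by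
          refine Real.exp_le_exp.2 ?_
          linarith [mul_le_mul_of_nonneg_right hS hlog]
      _ = ∏ _j ∈ S, (vacancy g : ℝ) := by
          rw [Real.exp_nat_mul, Real.exp_log (vacancy_pos hg), Finset.prod_const]
      _ ≤ _ := Finset.prod_le_prod (fun _ _ => (vacancy_pos hg).le) fun j _ =>
          vacancy_mono hg (hgh j)
  have hHS : ∑ j ∈ S, h j * occupation (h j) ≤ t * (G * occupation g) := by
    have hj : ∀ j, h j * occupation (h j) ≤ G * occupation g := fun j =>
      mul_le_mul (hhG j) (occupation_anti hg (hgh j)) (occupation_pos (hh j)).le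
        hG
    calc ∑ j ∈ S, h j * occupation (h j) ≤ S.card • (G * occupation g) :=
          Finset.sum_le_card_nsmul _ _ _ fun j _ => hj j
      _ = S.card * (G * occupation g) := nsmul_eq_mul _ _
      _ ≤ _ := mul_le_mul_of_nonneg_right hS (mul_nonneg hG (occupation_pos hg).le)
  rw [← prod_mul_prod_subtype_notMem S, ← sum_add_sum_subtype_notMem S,
    mul_comm (∏ j ∈ S, _), mul_assoc, mul_assoc]
  refine mul_le_mul_of_nonneg_left ?_ hpR
  rw [← Real.exp_add]
  refine le_trans ?_ (mul_le_mul_of_nonneg_right hpS (Real.exp_pos _).le)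
  rw [← Real.exp_add]
  refine Real.exp_le_exp.2 ?_
  linarith

/-! ### Comparison of the two bounds -/

/-- With the reduced energies in a fixed interval `[g, G]`, the proportion of deviating patterns is
exponentially small, up to a factor of order `exp (A √N)`. -/
theorem exists_ncard_deviatingPatterns_le {a₁ a₂ g G : ℝ} (ha₁ : 0 < a₁) (ha₂ : 0 < a₂)
    (hg : 0 < g) (hgG : g ≤ G) :
    ∃ (A : ℝ) (N₁ : ℕ), ∀ N : ℕ, N₁ ≤ N → ∀ (J : Type) [Fintype J] (lam h : J → ℝ) (E β ν : ℝ),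
      (∀ j, g ≤ h j) → (∀ j, h j ≤ G) → (∀ j, h j = β * lam j - ν) → 0 ≤ β →
      a₁ * N ≤ Fintype.card J → (Fintype.card J : ℝ) ≤ a₂ * N →
      ∑ j, occupation (h j) = N → β * ∑ j, lam j * occupation (h j) = β * E →
      ∑ j, lam j * occupation (h j) ≤ E →
      0 < (patterns lam N E).ncard ∧ ∀ (F : Finset J) (Δ : ℝ),
        ((deviatingPatterns lam N E h F Δ).ncard : ℝ) ≤ (patterns lam N E).ncard *
          (8 * Real.exp (A * √N - (N : ℝ) ^ (-(1 / 4) : ℝ) * Δ)) := by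
  set b := occupation g with hb
  set ρ := occupation G with hρ
  have hG : 0 < G := hg.trans_le hgG
  have hb0 : 0 < b := occupation_pos hg
  have hρ0 : 0 < ρ := occupation_pos hG
  set K := b + 8 * b ^ 2 with hK
  have hK0 : 0 < K := by positivity
  set C := K * a₂ + 2 with hC
  have hC0 : 0 < C := by positivity
  set c := C / ρ + 2 with hc
  have hc0 : 0 < c := by positivity
  set ℓ := -Real.log (vacancy g) with hℓ
  -- The summands of `A`: Chernoff's quadratic term, the vacancy factors of `S`, the mean exponent
  -- of `S`, and the fluctuation of the exponent off `S`. The threshold makes `√N` exceed `1`, `4b`,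
  -- `16b²` and `c / a₁`; the last ensures that there are enough states to choose `S`.
  refine ⟨K * a₂ + (c * ℓ + c * (G * b) + G * C),
    ⌈(1 + 4 * b + 16 * b ^ 2 + c / a₁) ^ 2⌉₊, ?_⟩
  intro N hN J _ lam h E β ν hgh hhG hdef hβ hcard₁ hcard₂ hNsum hE hE'
  set x := √(N : ℝ) with hx
  have hxlarge : 1 + 4 * b + 16 * b ^ 2 + c / a₁ ≤ x :=
    Real.le_sqrt_of_sq_le (Nat.ceil_le.1 hN)
  have hca : 0 < c / a₁ := by positivity
  have hx1 : 1 ≤ x := by nlinarith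
  have hx0 : 0 < x := by linarith
  have hx4 : 4 * b ≤ x := by nlinarith
  have hx16 : (4 * b) ^ 2 ≤ x := by nlinarith
  have hxc : c ≤ a₁ * x := by
    rw [← div_le_iff₀' ha₁]
    nlinarith
  have hxN : x ^ 2 = N := Real.sq_sqrt (Nat.cast_nonneg N)
  have hh : ∀ j, 0 < h j := fun j => hg.trans_le (hgh j)
  have hbj : ∀ j, occupation (h j) ≤ b := fun j => occupation_anti hg (hgh j)
  have hρj : ∀ j, ρ ≤ occupation (h j) := fun j => occupation_anti (hh j) (hhG j)
  -- Each state holds at least `ρ` particles on average, so `k` states release `C * x`. The `2` in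
  -- `c` pays for rounding up and for `j₀`.
  set k := ⌈C * x / ρ⌉₊ with hk
  have hk1 : C * x ≤ k * ρ := by
    rw [← div_le_iff₀ hρ0]
    exact Nat.le_ceil _
  have hk2 : (k : ℝ) + 1 ≤ c * x := by
    have h1 : (k : ℝ) < C * x / ρ + 1 := Nat.ceil_lt_add_one (by positivity)
    have h2 : c * x = C * x / ρ + 2 * x := by rw [hc]; ring
    linarith
  have hk3 : k < Fintype.card J := by
    have h1 : (k : ℝ) + 1 ≤ Fintype.card J := by
      refine hk2.trans (le_trans ?_ hcard₁)
      rw [← hxN]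
      nlinarith
    have h2 : k + 1 ≤ Fintype.card J := by exact_mod_cast h1
    omega
  obtain ⟨S, j₀, D, hScard, hj₀, hmin, hD, hDle, hS1, hS2⟩ :=
    exists_extremal_states lam (fun j => occupation (h j)) hk3 hρj hρ0.le hk1
  classical
  have hlow := quarter_le_ncard_patterns_mul (S := (S : Set J)) (j₀ := j₀) (a := a₂) (x := x)
    (D := D) (E := E) (N := N) (by exact_mod_cast hj₀) hh hhG hG hNsum hE' hbj hb0.le hx1 hx4
    (by rwa [hxN]) hD hmin (fun j hj => hDle j (by exact_mod_cast hj))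
    (by
      rw [← sum_add_sum_subtype_notMem S, add_comm]
      exact add_le_add_left hS1 _)
    (by
      rw [← sum_add_sum_subtype_notMem S, add_comm]
      exact add_le_add_left hS2 _)
  set V := (∏ j : {j // j ∉ (S : Set J)}, (vacancy (h j) : ℝ)) *
      Real.exp (-(∑ j : {j // j ∉ (S : Set J)}, h j * occupation (h j) - G * (C * x))) with hV
  set W := (∏ j, (vacancy (h j) : ℝ)) * Real.exp (-∑ j, h j * occupation (h j)) with hW
  have hW0 : 0 < W := mul_pos (Finset.prod_pos fun j _ => vacancy_pos (hh j)) (Real.exp_pos _)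
  have hSc : (S.card : ℝ) ≤ c * x := le_trans (by exact_mod_cast hScard) hk2
  have hVW : V ≤ W * Real.exp ((c * ℓ + c * (G * b) + G * C) * x) := by
    refine (weight_compl_le hg hG.le hgh hhG hSc (G * (C * x))).trans_eq ?_
    rw [hW, hℓ, hb]
    congr 2
    ring
  refine ⟨?_, fun F Δ => ?_⟩
  · rw [Nat.pos_iff_ne_zero]
    intro h0
    rw [h0] at hlow
    norm_num at hlow
  · have hN0 : 0 < (N : ℝ) := by rw [← hxN]; positivity
    set η := (N : ℝ) ^ (-(1 / 4) : ℝ) with hη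
    have hη0 : 0 < η := Real.rpow_pos_of_pos hN0 _
    have hη2 : η ^ 2 = 1 / x := by
      rw [hη, ← Real.rpow_natCast, ← Real.rpow_mul hN0.le, hx, Real.sqrt_eq_rpow,
        one_div (_ ^ _), ← Real.rpow_neg hN0.le]
      norm_num
    have hη1 : η ≤ 1 := by
      have : η ^ 2 ≤ 1 ^ 2 := by
        rw [hη2, one_pow]
        exact (div_le_one hx0).2 hx1
      exact le_of_sq_le_sq this zero_le_one
    have hη4 : 4 * b * η ≤ 1 := by
      refine le_of_sq_le_sq ?_ zero_le_one
      rw [mul_pow, hη2, one_pow, mul_one_div]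
      exact (div_le_one hx0).2 hx16
    have hup := ncard_deviatingPatterns_mul_le hh hdef hβ hNsum hE hbj hb0.le hη0.le hη1 hη4 F Δ
    have hcard : K * η ^ 2 * Fintype.card J ≤ K * a₂ * x := by
      rw [hη2, mul_assoc, mul_assoc]
      refine mul_le_mul_of_nonneg_left ?_ hK0.le
      rw [one_div, inv_mul_le_iff₀ hx0]
      refine hcard₂.trans_eq ?_
      rw [← hxN]
      ring
    have hM0 : (0 : ℝ) ≤ (patterns lam N E).ncard := Nat.cast_nonneg _
    refine le_of_mul_le_mul_right (hup.trans ?_) hW0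
    calc 2 * Real.exp (K * η ^ 2 * Fintype.card J - η * Δ)
        ≤ 2 * Real.exp (K * a₂ * x - η * Δ) := by gcongr
      -- `8` is the `2` from the two signs divided by the probability `1/4`.
      _ = 8 * Real.exp (K * a₂ * x - η * Δ) * (1 / 4) := by ring
      _ ≤ 8 * Real.exp (K * a₂ * x - η * Δ) * ((patterns lam N E).ncard *
            (W * Real.exp ((c * ℓ + c * (G * b) + G * C) * x))) := by
          refine mul_le_mul_of_nonneg_left (hlow.trans ?_) (by positivity)
          exact mul_le_mul_of_nonneg_left hVW hM0
      _ = (patterns lam N E).ncard * (8 * (Real.exp (K * a₂ * x - η * Δ) *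
            Real.exp ((c * ℓ + c * (G * b) + G * C) * x))) * W := by ring
      _ = _ := by
          rw [← Real.exp_add]
          congr 4
          ring

/-- The product of powers is `x ^ (1/2 + ε)`. Half of it absorbs `A * √x`; the other half beats
every power of `x`. -/
theorem eventually_exp_lt_div_rpow (A m : ℝ) {c ε : ℝ} (hc : 0 < c) (hε : 0 < ε) :
    ∀ᶠ x : ℝ in Filter.atTop,
      8 * Real.exp (A * √x - x ^ (-(1 / 4) : ℝ) * x ^ (3 / 4 + ε)) < c / x ^ m := by
  have hp : 0 < 1 / 2 + ε := by linarith
  have h1 := ((tendsto_rpow_mul_exp_neg_mul_atTop_nhds_zero (m / (1 / 2 + ε)) (1 / 2)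
    (by norm_num)).comp (tendsto_rpow_atTop hp)).eventually
      (gt_mem_nhds (show (0 : ℝ) < c / 8 by positivity))
  filter_upwards [h1, (tendsto_rpow_atTop hε).eventually_ge_atTop (2 * A),
    Filter.eventually_gt_atTop 0] with x hx hA hx0
  simp only [Function.comp_apply] at hx
  rw [← Real.rpow_mul hx0.le, mul_div_cancel₀ _ hp.ne'] at hx
  have h2 : x ^ (-(1 / 4) : ℝ) * x ^ (3 / 4 + ε) = x ^ (1 / 2 + ε) := by
    rw [← Real.rpow_add hx0]
    congr 1
    ring
  have h3 : A * √x ≤ 1 / 2 * x ^ (1 / 2 + ε) := by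
    rw [Real.rpow_add hx0, Real.sqrt_eq_rpow]
    nlinarith [mul_le_mul_of_nonneg_right hA (Real.rpow_pos_of_pos hx0 (1 / 2)).le]
  have h4 : Real.exp (A * √x - x ^ (-(1 / 4) : ℝ) * x ^ (3 / 4 + ε)) ≤
      Real.exp (-(1 / 2) * x ^ (1 / 2 + ε)) := by
    rw [h2]
    exact Real.exp_le_exp.2 (by linarith)
  have hxm : 0 < x ^ m := Real.rpow_pos_of_pos hx0 m
  rw [lt_div_iff₀ hxm]
  nlinarith [mul_le_mul_of_nonneg_left h4 hxm.le]

/-! ### From levels to states, and bounds for the reduced energies -/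

section Levels

variable {s : ℕ} {q : Fin s → ℕ}

theorem sum_states (f : Fin s → ℝ) :
    ∑ j : (Σ i, Fin (q i)), f j.1 = ∑ i, (q i : ℝ) * f i := by
  rw [Fintype.sum_sigma]
  simp

theorem sum_states_mul (n : Variant q) (f : Fin s → ℝ) :
    ∑ j : (Σ i, Fin (q i)), f j.1 * (n j : ℝ) = ∑ i, f i * (levelNumber n i : ℝ) := by
  rw [Fintype.sum_sigma]
  simp [levelNumber, Finset.mul_sum]

theorem boseEinstein_eq (lam : Fin s → ℝ) (β ν : ℝ) (i : Fin s) :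
    boseEinstein q lam β ν i = q i * occupation (β * lam i - ν) := by
  rw [boseEinstein, occupation, mul_one_div]

theorem admissible_eq_patterns (lam : Fin s → ℝ) (N : ℕ) (E : ℝ) :
    admissible q lam N E = patterns (fun j : Σ i, Fin (q i) => lam j.1) N E := by
  ext n
  have h1 : ∑ j : (Σ i, Fin (q i)), n j = ∑ i, levelNumber n i := Fintype.sum_sigma _
  change (∑ i, levelNumber n i = N ∧ _) ↔ (∑ j, n j = N ∧ _)
  rw [h1, sum_states_mul]

theorem deviating_eq_deviatingPatterns (lam : Fin s → ℝ) (N : ℕ) (E β ν : ℝ) (l : ℕ) (Δ : ℝ) :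
    deviating q lam N E β ν l Δ = deviatingPatterns (fun j : Σ i, Fin (q i) => lam j.1) N E
      (fun j => β * lam j.1 - ν) ((firstLevels s l).sigma fun _ => Finset.univ) Δ := by
  unfold deviating deviatingPatterns
  rw [admissible_eq_patterns]
  ext n
  refine and_congr_right fun _ => ?_
  rw [Finset.sum_sigma, Finset.sum_sigma]
  simp only [levelNumber, Nat.cast_sum, boseEinstein_eq, Finset.sum_const, Finset.card_univ,
    Fintype.card_fin, nsmul_eq_mul]

/-- The reduced energies are bounded in terms of the ratio of states to particles. -/
theorem reducedEnergy_bounds {lam : Fin s → ℝ} {a₁ a₂ B β₀ β ν N : ℝ} (ha₁ : 0 < a₁)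
    (ha₂ : 0 < a₂) (hN : 0 < N) (h₁ : a₁ * N ≤ ∑ i, (q i : ℝ)) (h₂ : ∑ i, (q i : ℝ) ≤ a₂ * N)
    (hlam : ∀ i, 0 ≤ lam i ∧ lam i ≤ B) (hβ : 0 ≤ β) (hβ₀ : β ≤ β₀)
    (hpos : ∀ i, 0 < β * lam i - ν) (hsum : ∑ i, boseEinstein q lam β ν i = N) (i : Fin s) :
    Real.log (1 + a₁) - β₀ * B ≤ β * lam i - ν ∧
      β * lam i - ν ≤ β₀ * B + Real.log (1 + a₂) := by
  have hB : 0 ≤ B := (hlam i).1.trans (hlam i).2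
  have hβB : β * B ≤ β₀ * B := mul_le_mul_of_nonneg_right hβ₀ hB
  -- Reduced energies differ by at most `β₀ * B`. So one of them, shifted by this amount, bounds all
  -- of them, and the equation for `N` compares `exp L - 1` with the ratio of states to particles.
  have hclose : ∀ j j', β * lam j ≤ β * lam j' + β₀ * B := fun j j' => by
    nlinarith [mul_le_mul_of_nonneg_left (hlam j).2 hβ, mul_nonneg hβ (hlam j').1]
  have hsum' : ∑ j, (q j : ℝ) * occupation (β * lam j - ν) = N := by
    rw [← hsum]
    exact Finset.sum_congr rfl fun j _ => (boseEinstein_eq lam β ν j).symm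
  constructor
  · set L := β * lam i - ν + β₀ * B with hL
    have hL0 : 0 < L := by
      have h0 : 0 ≤ β₀ * B := mul_nonneg (hβ.trans hβ₀) hB
      linarith [hpos i]
    have h3 : (∑ j, (q j : ℝ)) * occupation L ≤ N := by
      rw [← hsum', Finset.sum_mul]
      refine Finset.sum_le_sum fun j _ => mul_le_mul_of_nonneg_left ?_ (Nat.cast_nonneg _)
      exact occupation_anti (hpos j) (by linarith [hclose j i])
    have h4 : 0 < Real.exp L - 1 := sub_pos.2 (Real.one_lt_exp_iff.2 hL0)
    rw [occupation, mul_one_div, div_le_iff₀ h4] at h3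
    have h5 : a₁ ≤ Real.exp L - 1 := by
      refine le_of_mul_le_mul_left ?_ hN
      linarith
    have h6 : Real.log (1 + a₁) ≤ L :=
      (Real.log_le_iff_le_exp (by linarith)).2 (by linarith)
    linarith
  · by_contra! hlt
    set L := β * lam i - ν - β₀ * B with hL
    have hlog : 0 < Real.log (1 + a₂) := Real.log_pos (by linarith)
    have hL0 : 0 < L := by linarith
    have h3 : N ≤ (∑ j, (q j : ℝ)) * occupation L := by
      rw [← hsum', Finset.sum_mul]
      refine Finset.sum_le_sum fun j _ => mul_le_mul_of_nonneg_left ?_ (Nat.cast_nonneg _)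
      exact occupation_anti hL0 (by linarith [hclose i j])
    have h4 : 0 < Real.exp L - 1 := sub_pos.2 (Real.one_lt_exp_iff.2 hL0)
    rw [occupation, mul_one_div, le_div_iff₀ h4] at h3
    have h5 : Real.exp L - 1 ≤ a₂ := by
      refine le_of_mul_le_mul_left ?_ hN
      linarith
    have h6 : L ≤ Real.log (1 + a₂) :=
      (Real.le_log_iff_exp_le (by linarith)).2 (by linarith)
    linarith

end Levels

end OperationalRisk

open OperationalRisk in
theorem lemma1 (a₁ a₂ B β₀ δ ε : ℝ) (ha₁ : 0 < a₁) (hδ : 0 < δ) (hε : 0 < ε)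
    (c₁ m : ℝ) (hc₁ : 0 < c₁) :
    ∃ N₀ : ℕ, ∀ N : ℕ, N₀ ≤ N →
      ∀ (s : ℕ) (q : Fin s → ℕ) (lam : Fin s → ℝ) (E β' ν' : ℝ) (l : ℕ),
        -- the number `Q` of states is comparable with `N` (if all `q i = 1`, then `Q = s`)
        a₁ * N ≤ ∑ i, (q i : ℝ) → ∑ i, (q i : ℝ) ≤ a₂ * N →
        (∀ i, 0 ≤ lam i ∧ lam i ≤ B) →
        0 ≤ β' → β' ≤ β₀ → (∀ i, 0 < β' * lam i - ν') →
        -- `β'`, `ν'` are determined by `N` and `E`; `β' = 0` if the bound `E` is not active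
        ∑ i, boseEinstein q lam β' ν' i = N →
        (∑ i, lam i * boseEinstein q lam β' ν' i = E ∨
          (β' = 0 ∧ ∑ i, lam i * boseEinstein q lam β' ν' i ≤ E)) →
        -- no condensation: automatic for small `β₀`, otherwise a uniform gap
        (Real.exp (β₀ * B) < 1 + a₁ ∨ ∀ i, δ ≤ β' * lam i - ν') →
        ε * ∑ i, (q i : ℝ) ≤ ∑ i ∈ firstLevels s l, (q i : ℝ) →
        ((deviating q lam N E β' ν' l ((N : ℝ) ^ (3 / 4 + ε))).ncard : ℝ) <
          c₁ * ((admissible q lam N E).ncard : ℝ) / (N : ℝ) ^ m := by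
  -- One lower bound `g` serves both alternatives of the no-condensation hypothesis.
  obtain ⟨g, hg, hgδ, hga⟩ : ∃ g : ℝ, 0 < g ∧ g ≤ δ ∧
      (Real.exp (β₀ * B) < 1 + a₁ → g ≤ Real.log (1 + a₁) - β₀ * B) := by
    by_cases h : Real.exp (β₀ * B) < 1 + a₁
    · refine ⟨min δ (Real.log (1 + a₁) - β₀ * B), lt_min hδ ?_, min_le_left _ _,
        fun _ => min_le_right _ _⟩
      exact sub_pos.2 ((Real.lt_log_iff_exp_lt (by linarith)).2 h)
    · exact ⟨δ, hδ, le_rfl, fun h' => absurd h' h⟩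
  -- `a₂` may be any real number, so it is replaced by a positive upper bound.
  have ha₂ : 0 < max a₂ a₁ := lt_max_of_lt_right ha₁
  obtain ⟨A, N₁, hmain⟩ := exists_ncard_deviatingPatterns_le ha₁ ha₂ hg
    (le_max_left g (β₀ * B + Real.log (1 + max a₂ a₁)))
  obtain ⟨N₂, hasymp⟩ := Filter.eventually_atTop.1
    (tendsto_natCast_atTop_atTop.eventually (eventually_exp_lt_div_rpow A m hc₁ hε))
  refine ⟨max 1 (max N₁ N₂), fun N hN s q lam E β' ν' l h₁ h₂ hlam hβ hβ₀ hpos hsum hE hgap _ => ?_⟩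
  have hN1 : 0 < (N : ℝ) := by exact_mod_cast (le_max_left _ _).trans hN
  have h₂' : ∑ i, (q i : ℝ) ≤ max a₂ a₁ * N :=
    h₂.trans (mul_le_mul_of_nonneg_right (le_max_left _ _) hN1.le)
  have hbd := reducedEnergy_bounds ha₁ ha₂ hN1 h₁ h₂' hlam hβ hβ₀ hpos hsum
  have hcard : (Fintype.card (Σ i, Fin (q i)) : ℝ) = ∑ i, (q i : ℝ) := by
    rw [Fintype.card_sigma]
    simp
  have hsumN : ∑ j : (Σ i, Fin (q i)), occupation (β' * lam j.1 - ν') = N := by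
    rw [sum_states fun i => occupation (β' * lam i - ν'), ← hsum]
    exact Finset.sum_congr rfl fun i _ => (boseEinstein_eq lam β' ν' i).symm
  have hsumE : ∑ j : (Σ i, Fin (q i)), lam j.1 * occupation (β' * lam j.1 - ν') =
      ∑ i, lam i * boseEinstein q lam β' ν' i := by
    rw [sum_states fun i => lam i * occupation (β' * lam i - ν')]
    refine Finset.sum_congr rfl fun i _ => ?_
    rw [boseEinstein_eq]
    ring
  obtain ⟨hM, hdev⟩ := hmain N ((le_max_left _ _).trans ((le_max_right _ _).trans hN))
    (Σ i, Fin (q i)) (fun j => lam j.1) (fun j => β' * lam j.1 - ν') E β' ν'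
    (fun j => hgap.elim (fun h => (hga h).trans (hbd j.1).1) fun h => hgδ.trans (h j.1))
    (fun j => (hbd j.1).2.trans (le_max_right _ _)) (fun _ => rfl) hβ (by rwa [hcard])
    (by rwa [hcard]) hsumN
    (by
      rw [hsumE]
      rcases hE with h | ⟨h, -⟩
      · rw [h]
      · rw [h, zero_mul, zero_mul])
    (by
      rw [hsumE]
      exact hE.elim le_of_eq And.right)
  rw [deviating_eq_deviatingPatterns, admissible_eq_patterns]
  refine (hdev _ _).trans_lt ?_
  rw [mul_comm c₁, mul_div_assoc]
  exact mul_lt_mul_of_pos_left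
    (hasymp N ((le_max_right _ _).trans ((le_max_right _ _).trans hN))) (by exact_mod_cast hM)
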